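/- Let $P$ be any set of atoms. Formulas of multiplicative additive linear logic are built from atoms and the units $1,\bot,\top,0$ with $\neg$, the multiplicative conjunction $\otimes$ and disjunction $+$, and $\oplus,\&,\multimap,\leadsto$. Relevant logic $\mathsf R$ is the following Hilbert system. Its axioms are all formulas of the following forms: $A\multimap A$; $(A\multimap B)\multimap((B\multimap C)\multimap(A\multimap C))$; $(A\multimap(B\multimap C))\multimap(B\multimap(A\multimap C))$; $\neg\neg A\multimap A$; $(A\multimap B)\multimap(\neg B\multimap\neg A)$; $A\multimap(B\multimap A\otimes B)$; $(A\multimap(B\multimap C))\multimap(A\otimes B\multimap C)$; $1$; $1\multimap(A\multimap A)$; $0\multimap\neg 1$; $\neg 1\multimap\neg 0$; $A\& B\multimap A$; $A\& B\multimap B$; $((A\multimap B)\&(A\multimap C))\multimap(A\multimap B\& C)$; $A\multimap A\oplus B$; $B\multimap A\oplus B$; $((A\multimap C)\&(B\multimap C))\multimap(A\oplus B\multimap C)$; both directions of the equivalences of $A\& B$ with $\neg(\neg A\oplus\neg B)$, of $A+ B$ with $\neg A\multimap B$, of $A\otimes B$ with $\neg(\neg A+ \neg B)$, of $\bot$ with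 $\neg 1$, and of $A\leadsto B$ with $\neg A\oplus B$; $0\multimap A$; $A\multimap\top$; contraction $(A\multimap(A\multimap B))\multimap(A\multimap B)$; and distributivity $A\&(B\oplus C)\multimap(A\& B)\oplus(A\& C)$ and $(A\oplus B)\&(A\oplus C)\multimap A\oplus(B\& C)$. Derivability $\Gamma\vdash A$ from a finite multiset $\Gamma$ is generated by: $A\vdash A$; $\vdash B$ for axioms $B$; from $\Gamma\vdash A$ and $\Gamma'\vdash A\multimap B$ infer $\Gamma,\Gamma'\vdash B$; from $\Gamma\vdash A$ and $\Gamma\vdash B$ infer $\Gamma\vdash A\& B$. A finite multiset $Y$ of formulas is inconsistent if $Y\vdash\bot$, and consistent otherwise; it is robustly consistent if it and all its proper submultisets are consistent, and minimally inconsistent if it is inconsistent and all its proper submultisets are consistent. A contradiction is a formula $A$ with $A\vdash\bot$; a tautology is a formula $A$ with $\vdash A$. An additive formula ($\mathsf{AR}$) is one built from atoms with $\neg,\&,\oplus,\leadsto$ only (no units). The complement $\sim A$ is $B$ if $A=\neg B$, and $\neg A$ if $A$ is not a negation. An $\mathsf{AR}$ agenda is a finite multiset $\Phi$ of additive formulas,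 closed under complements and containing no tautology and no contradiction. A judgment multiset is a submultiset $J$ of $\Phi$; it is complete if for each $A\in\Phi$ it contains $A$ or $\sim A$, and complement-free if it never contains both $A$ and $\sim A$. There are $n\ge 3$ agents, $n$ odd. An aggregation procedure maps each profile $(J_1,\dots,J_n)$ of admissible judgment multisets to a submultiset $F(\mathbf J)$ of $\Phi$; it is robustly consistent if all its outcomes are. Theorem. (1) Every inconsistent multiset of additive formulas has cardinality $1$ or $2$; every minimally inconsistent multiset of additive formulas none of which is a contradiction (in particular every minimally inconsistent multiset of formulas of an $\mathsf{AR}$ agenda) has cardinality exactly $2$. (2) $\mathsf{AR}$ is safe for MAJ: for every $\mathsf{AR}$ agenda $\Phi$, every aggregation procedure $F$ defined on the profiles of robustly consistent and complete judgment multisets that satisfies the following axioms is robustly consistent. (WR) All outcomes are complete and complement-free. (A) $F$ is invariant under permutations of the agents. (I) If $A\in\Phi$ is accepted by the same agents in $\mathbf J$ and in $\mathbf J'$, then $A\in F(\mathbf J)\Leftrightarrow A\in F(\mathbf J')$. (N) If $A,B\in\Phi$ are accepted by the same agents in $\mathbf J$, then $A\in F(\mathbf J)\Leftrightarrow B\in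 F(\mathbf J)$. (M) If $\mathbf J'$ differs from $\mathbf J$ only in the judgment of agent $i$, $A\in\Phi$, $A\notin J_i$, $A\in J'_i$ and $A\in F(\mathbf J)$, then $A\in F(\mathbf J')$. (3) For every $\mathsf{AR}$ agenda, every majority rule, that is, every procedure with $A\in F(\mathbf J)$ iff $|\{i: A\in J_i\}|>n/2$, is robustly consistent, both on the profiles of robustly consistent judgment multisets and on the profiles of robustly consistent and complete ones. -/

import Mathlib

namespace RelevantJA

universe u

/-- Formulas of multiplicative additive linear logic over the propositional atoms `P`. -/
inductive Fml (P : Type u) : Type u where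
  /-- propositional atoms -/
  | atom : P → Fml P
  /-- the multiplicative unit `1` -/
  | one : Fml P
  /-- the multiplicative falsum `⊥` -/
  | bot : Fml P
  /-- the additive truth `⊤` -/
  | top : Fml P
  /-- the additive falsum `0` -/
  | zero : Fml P
  /-- negation `¬ A` -/
  | neg : Fml P → Fml P
  /-- multiplicative conjunction `A ⊗ B` -/
  | tensor : Fml P → Fml P → Fml P
  /-- multiplicative disjunction `A ⅋ B` -/
  | par : Fml P → Fml P → Fml P
  /-- additive disjunction `A ⊕ B` -/
  | plus : Fml P → Fml P → Fml P
  /-- additive conjunction `A & B` -/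
  | wth : Fml P → Fml P → Fml P
  /-- multiplicative implication `A ⊸ B` -/
  | limp : Fml P → Fml P → Fml P
  /-- additive implication `A ⇝ B` -/
  | aimp : Fml P → Fml P → Fml P

namespace Fml

variable {P : Type u}

/-- The unit-free additive fragment: formulas built from atoms by negation, additive conjunction,
additive disjunction and additive implication. -/
def IsAdditive : Fml P → Prop
  | atom _ => True
  | neg A => A.IsAdditive
  | plus A B => A.IsAdditive ∧ B.IsAdditive
  | wth A B => A.IsAdditive ∧ B.IsAdditive
  | aimp A B => A.IsAdditive ∧ B.IsAdditive
  | one => False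
  | bot => False
  | top => False
  | zero => False
  | tensor _ _ => False
  | par _ _ => False
  | limp _ _ => False

/-- The complement `∼ A`: it is `B` if `A = ¬ B`, and `¬ A` if `A` is not a negation. -/
def compl : Fml P → Fml P
  | neg B => B
  | A => neg A

end Fml

open Fml

section Logic

variable {P : Type u}

/-- Axioms of the Hilbert system for relevant logic `R`: those of the Hilbert system for
multiplicative additive linear logic, contraction, and distributivity of the additives. -/
inductive RAxiom : Fml P → Prop where
  | id (A) : RAxiom (limp A A)
  | trans (A B C) : RAxiom (limp (limp A B) (limp (limp B C) (limp A C)))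
  | exch (A B C) : RAxiom (limp (limp A (limp B C)) (limp B (limp A C)))
  | dne (A) : RAxiom (limp (neg (neg A)) A)
  | contrapos (A B) : RAxiom (limp (limp A B) (limp (neg B) (neg A)))
  | tensor_intro (A B) : RAxiom (limp A (limp B (tensor A B)))
  | tensor_elim (A B C) : RAxiom (limp (limp A (limp B C)) (limp (tensor A B) C))
  | one : RAxiom one
  | one_elim (A) : RAxiom (limp one (limp A A))
  | zero_negOne : RAxiom (limp zero (neg one))
  | negOne_negZero : RAxiom (limp (neg one) (neg zero))
  | wth_left (A B) : RAxiom (limp (wth A B) A)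
  | wth_right (A B) : RAxiom (limp (wth A B) B)
  | wth_intro (A B C) : RAxiom (limp (wth (limp A B) (limp A C)) (limp A (wth B C)))
  | plus_left (A B) : RAxiom (limp A (plus A B))
  | plus_right (A B) : RAxiom (limp B (plus A B))
  | wth_def (A B) : RAxiom (limp (wth A B) (neg (plus (neg A) (neg B))))
  | wth_def' (A B) : RAxiom (limp (neg (plus (neg A) (neg B))) (wth A B))
  | par_def (A B) : RAxiom (limp (par A B) (limp (neg A) B))
  | par_def' (A B) : RAxiom (limp (limp (neg A) B) (par A B))
  | tensor_def (A B) : RAxiom (limp (tensor A B) (neg (par (neg A) (neg B))))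
  | tensor_def' (A B) : RAxiom (limp (neg (par (neg A) (neg B))) (tensor A B))
  | plus_elim (A B C) : RAxiom (limp (wth (limp A C) (limp B C)) (limp (plus A B) C))
  /- the two falsa, additive truth and additive implication -/
  | bot_def : RAxiom (limp bot (neg one))
  | bot_def' : RAxiom (limp (neg one) bot)
  | zero_elim (A) : RAxiom (limp zero A)
  | top_intro (A) : RAxiom (limp A top)
  | aimp_def (A B) : RAxiom (limp (aimp A B) (plus (neg A) B))
  | aimp_def' (A B) : RAxiom (limp (plus (neg A) B) (aimp A B))
  /- contraction -/
  | contraction (A B) : RAxiom (limp (limp A (limp A B)) (limp A B))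
  /- distributivity of the additives -/
  | distrib (A B C) : RAxiom (limp (wth A (plus B C)) (plus (wth A B) (wth A C)))
  | distrib' (A B C) : RAxiom (limp (wth (plus A B) (plus A C)) (plus A (wth B C)))

/-- `RDeriv Γ A`: there is a deduction tree in `R` with conclusion `Γ ⊢ A`, where `Γ` is the
multiset of assumptions. -/
inductive RDeriv : Multiset (Fml P) → Fml P → Prop where
  | assumption (A : Fml P) : RDeriv {A} A
  | ax {A : Fml P} (h : RAxiom A) : RDeriv 0 A
  | limp_rule {Γ Γ' : Multiset (Fml P)} {A B : Fml P}
      (h : RDeriv Γ A) (h' : RDeriv Γ' (limp A B)) : RDeriv (Γ + Γ') B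
  | wth_rule {Γ : Multiset (Fml P)} {A B : Fml P}
      (h : RDeriv Γ A) (h' : RDeriv Γ B) : RDeriv Γ (wth A B)

/-- A multiset of formulas is inconsistent if it derives absurdity `⊥`. -/
def Inconsistent (Y : Multiset (Fml P)) : Prop := RDeriv Y bot

/-- A multiset of formulas is consistent if it does not derive absurdity. -/
def Consistent (Y : Multiset (Fml P)) : Prop := ¬ Inconsistent Y

/-- A multiset is robustly consistent if it and all its proper submultisets are consistent. -/
def RobustlyConsistent (Y : Multiset (Fml P)) : Prop :=
  Consistent Y ∧ ∀ Z, Z < Y → Consistent Z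

/-- A multiset is minimally inconsistent if it is inconsistent and all its proper submultisets
are consistent. -/
def MinimallyInconsistent (Y : Multiset (Fml P)) : Prop :=
  Inconsistent Y ∧ ∀ Z, Z < Y → Consistent Z

/-- `A` is a tautology of `R`. -/
def Tautology (A : Fml P) : Prop := RDeriv 0 A

/-- `A` is a contradiction of `R`. -/
def Contradiction (A : Fml P) : Prop := Inconsistent {A}

/-- An agenda in the additive fragment `AR`: a finite multiset of additive formulas that is closed
under complements and contains neither tautologies nor contradictions. -/
structure IsARAgenda (Φ : Multiset (Fml P)) : Prop where
  additive : ∀ A ∈ Φ, A.IsAdditive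
  compl_mem : ∀ A ∈ Φ, A.compl ∈ Φ
  not_tautology : ∀ A ∈ Φ, ¬ Tautology A
  not_contradiction : ∀ A ∈ Φ, ¬ Contradiction A

/-- `J` is complete with respect to the agenda `Φ`. -/
def Complete (Φ J : Multiset (Fml P)) : Prop := ∀ A ∈ Φ, A ∈ J ∨ A.compl ∈ J

/-- `J` does not contain a formula together with its complement. -/
def ComplementFree (J : Multiset (Fml P)) : Prop := ∀ A, ¬ (A ∈ J ∧ A.compl ∈ J)

/-- The robustly consistent judgment multisets on the agenda `Φ`. -/
def Judgments (Φ : Multiset (Fml P)) : Set (Multiset (Fml P)) :=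
  {J | J ≤ Φ ∧ RobustlyConsistent J}

/-- The robustly consistent and complete judgment multisets on the agenda `Φ`. -/
def CompleteJudgments (Φ : Multiset (Fml P)) : Set (Multiset (Fml P)) :=
  {J | J ≤ Φ ∧ RobustlyConsistent J ∧ Complete Φ J}

/-- Aggregation procedures for `n` agents: each profile of judgment multisets from `D` is mapped to
a submultiset of the agenda `Φ`. -/
abbrev Aggregator (n : ℕ) (D : Set (Multiset (Fml P))) (Φ : Multiset (Fml P)) : Type u :=
  (Fin n → D) → {M : Multiset (Fml P) // M ≤ Φ}

namespace Aggregator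

variable {n : ℕ} {D : Set (Multiset (Fml P))} {Φ : Multiset (Fml P)}

/-- A majority rule: a formula is accepted iff more than half of the agents accept it. -/
def IsMajorityRule (F : Aggregator n D Φ) : Prop :=
  ∀ (J : Fin n → D) (A : Fml P),
    A ∈ (F J).1 ↔ (n : ℝ) / 2 < ({i | A ∈ (J i).1} : Set (Fin n)).ncard

/-- Weak rationality (WR). -/
def WeaklyRational (F : Aggregator n D Φ) : Prop :=
  ∀ J : Fin n → D, Complete Φ (F J).1 ∧ ComplementFree (F J).1

/-- Anonymity (A). -/
def Anonymous (F : Aggregator n D Φ) : Prop :=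
  ∀ (J : Fin n → D) (σ : Equiv.Perm (Fin n)), F J = F (fun i => J (σ i))

/-- Independence (I). -/
def Independent (F : Aggregator n D Φ) : Prop :=
  ∀ A ∈ Φ, ∀ J J' : Fin n → D, (∀ i, A ∈ (J i).1 ↔ A ∈ (J' i).1) →
    (A ∈ (F J).1 ↔ A ∈ (F J').1)

/-- Neutrality (N). -/
def Neutral (F : Aggregator n D Φ) : Prop :=
  ∀ A ∈ Φ, ∀ B ∈ Φ, ∀ J : Fin n → D, (∀ i, A ∈ (J i).1 ↔ B ∈ (J i).1) →
    (A ∈ (F J).1 ↔ B ∈ (F J).1)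

/-- Monotonicity (M): here `J'` is `J` with the judgment of agent `i` replaced by `K`. -/
def Monotonic (F : Aggregator n D Φ) : Prop :=
  ∀ A ∈ Φ, ∀ (J : Fin n → D) (i : Fin n) (K : D), A ∉ (J i).1 → A ∈ K.1 →
    A ∈ (F J).1 → A ∈ (F (Function.update J i K)).1

/-- The class MAJ of axioms: (WR), (A), (I), (N) and (M). -/
def SatisfiesMAJ (F : Aggregator n D Φ) : Prop :=
  F.WeaklyRational ∧ F.Anonymous ∧ F.Independent ∧ F.Neutral ∧ F.Monotonic

/-- Every outcome of the aggregation procedure is robustly consistent. -/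
def IsRobustlyConsistent (F : Aggregator n D Φ) : Prop :=
  ∀ J : Fin n → D, RobustlyConsistent (F J).1

end Aggregator

/-- The agenda `Φ` is safe for MAJ with `n` agents, individual judgments being complete. -/
def SafeForMAJ (n : ℕ) (Φ : Multiset (Fml P)) : Prop :=
  ∀ F : Aggregator n (CompleteJudgments Φ) Φ, F.SatisfiesMAJ → F.IsRobustlyConsistent

end Logic

end RelevantJA

open RelevantJA

/-! Every additive formula takes the middle value of a five-element chain model of `R` when all
atoms do, and any product of three or more middle values is `⊤`, which is not below `⊥`. So at most
two additive formulas can derive `⊥`, and the two-valued model excludes the empty multiset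
(`Inconsistent.card_eq_one_or_two`). By contraction, `{A, A}` is inconsistent only if `A` is a
contradiction. Over an agenda, robust consistency is therefore consistency of pairs of distinct
formulas (`IsARAgenda.robustlyConsistent`), and two strict majorities share an agent, who accepts no
inconsistent pair. For MAJ, suppose an inconsistent pair `A`, `B` is accepted. Switching the agents
who accept neither to a complete judgment containing `A` makes `B` and `∼A` have the same
supporters; then (M), (I) and (N) put both `A` and `∼A` in the outcome, against (WR). -/

namespace RelevantJA

open Fml

variable {P : Type u}

/-! ### Soundness in two finite models, and the bound on inconsistent multisets. -/

section Models

/-- Truth-value semantics, every atom being true. -/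
def Fml.boolEval : Fml P → Bool
  | atom _ => true
  | one => true
  | bot => false
  | top => true
  | zero => false
  | neg A => !A.boolEval
  | tensor A B => A.boolEval && B.boolEval
  | par A B => A.boolEval || B.boolEval
  | plus A B => A.boolEval || B.boolEval
  | wth A B => A.boolEval && B.boolEval
  | limp A B => !A.boolEval || B.boolEval
  | aimp A B => !A.boolEval || B.boolEval

lemma RAxiom.boolEval {A : Fml P} (h : RAxiom A) : A.boolEval = true := by
  cases h <;> simp only [Fml.boolEval] <;> grind

lemma RDeriv.boolEval {Γ : Multiset (Fml P)} {A : Fml P} (h : RDeriv Γ A) :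
    (∀ B ∈ Γ, B.boolEval = true) → A.boolEval = true := by
  induction h with
  | assumption A => intro h; exact h A (by simp)
  | ax h => intro _; exact h.boolEval
  | limp_rule h h' ih ih' =>
    intro hΓ
    have h1 := ih fun B hB => hΓ B (Multiset.mem_add.2 (.inl hB))
    have h2 := ih' fun B hB => hΓ B (Multiset.mem_add.2 (.inr hB))
    simpa [Fml.boolEval, h1] using h2
  | wth_rule h h' ih ih' => intro hΓ; simp [Fml.boolEval, ih hΓ, ih' hΓ]

/-- The chain below cannot show this: its empty product `1` lies below `⊥`. -/
lemma consistent_zero : Consistent (0 : Multiset (Fml P)) := fun h => by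
  simpa [Fml.boolEval] using h.boolEval (by simp)

/-- The five-element chain `0 < 1 < a < ⊥ < ⊤`, whose middle element is its own negation and
satisfies `a ⊗ a = ⊥` and `a ⊗ a ⊗ a = ⊤`: the nonzero elements multiply by truncated addition
of their heights above `1`. -/
def chainMul (x y : Fin 5) : Fin 5 :=
  if x = 0 ∨ y = 0 then 0 else ⟨min 4 (x.val + y.val - 1), by omega⟩

/-- Implication on the five-element chain. -/
def chainImp (x y : Fin 5) : Fin 5 := (chainMul x y.rev).rev

/-- Semantics in the five-element chain, every atom being interpreted by the middle element. -/
def Fml.chainEval : Fml P → Fin 5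
  | atom _ => 2
  | one => 1
  | bot => 3
  | top => 4
  | zero => 0
  | neg A => A.chainEval.rev
  | tensor A B => chainMul A.chainEval B.chainEval
  | par A B => (chainMul A.chainEval.rev B.chainEval.rev).rev
  | plus A B => max A.chainEval B.chainEval
  | wth A B => min A.chainEval B.chainEval
  | limp A B => chainImp A.chainEval B.chainEval
  | aimp A B => max A.chainEval.rev B.chainEval

/-- A finite check. Contraction is valid because `x ≤ x ⊗ x` on the chain, and distributivity
because a chain is a distributive lattice. -/
lemma RAxiom.one_le_chainEval {A : Fml P} (h : RAxiom A) : 1 ≤ A.chainEval := by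
  cases h <;> simp only [Fml.chainEval] <;>
    first
    | decide
    | (generalize Fml.chainEval _ = x; revert x; decide)
    | (generalize Fml.chainEval _ = x; generalize Fml.chainEval _ = y; revert x y; decide)
    | (generalize Fml.chainEval _ = x; generalize Fml.chainEval _ = y
       generalize Fml.chainEval _ = z; revert x y z; decide)

/-- Interpretation of a multiset of assumptions: the product of the values of its members. -/
def chainProd (Γ : Multiset (Fml P)) : Fin 5 :=
  letI : Std.Commutative chainMul := ⟨by decide⟩
  letI : Std.Associative chainMul := ⟨by decide⟩
  (Γ.map Fml.chainEval).fold chainMul 1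

lemma chainProd_zero : chainProd (0 : Multiset (Fml P)) = 1 := rfl

lemma chainProd_cons (A : Fml P) (Γ : Multiset (Fml P)) :
    chainProd (A ::ₘ Γ) = chainMul A.chainEval (chainProd Γ) := by
  simp [chainProd]

lemma chainProd_add (Γ Δ : Multiset (Fml P)) :
    chainProd (Γ + Δ) = chainMul (chainProd Γ) (chainProd Δ) := by
  have h1 : ∀ x, chainMul 1 x = x := by decide
  have h2 : ∀ x y z, chainMul (chainMul x y) z = chainMul x (chainMul y z) := by decide
  induction Γ using Multiset.induction_on with
  | empty => rw [zero_add, chainProd_zero, h1]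
  | cons A Γ ih => rw [Multiset.cons_add, chainProd_cons, chainProd_cons, ih, h2]

/-- Soundness with assumptions multiplied rather than met, so that their number matters. -/
lemma RDeriv.chainProd_le {Γ : Multiset (Fml P)} {A : Fml P} (h : RDeriv Γ A) :
    chainProd Γ ≤ A.chainEval := by
  induction h with
  | assumption A =>
    rw [← Multiset.cons_zero, chainProd_cons, chainProd_zero]
    generalize A.chainEval = x
    revert x; decide
  | ax h => exact h.one_le_chainEval
  | @limp_rule Γ Γ' A B h h' ih ih' =>
    rw [chainProd_add]
    have mp : ∀ x y, chainMul x (chainImp x y) ≤ y := by decide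
    have mono : ∀ x y z, y ≤ z → chainMul x y ≤ chainMul x z := by decide
    have comm : ∀ x y, chainMul x y = chainMul y x := by decide
    refine le_trans (mono _ _ _ ih') ?_
    rw [comm]
    refine le_trans (mono _ _ _ ih) ?_
    rw [comm]
    exact mp _ _
  | wth_rule h h' ih ih' => exact le_min ih ih'

/-- The middle element is fixed by `Fin.rev`, and `min` and `max` are idempotent. -/
lemma Fml.IsAdditive.chainEval_eq {A : Fml P} (h : A.IsAdditive) : A.chainEval = 2 := by
  induction A with
  | atom p => rfl
  | neg A ih => simp only [Fml.chainEval, ih h]; decide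
  | plus A B ihA ihB => simp [Fml.chainEval, ihA h.1, ihB h.2]
  | wth A B ihA ihB => simp [Fml.chainEval, ihA h.1, ihB h.2]
  | aimp A B ihA ihB => simp only [Fml.chainEval, ihA h.1, ihB h.2]; decide
  | _ => exact h.elim

lemma chainProd_of_three_le_card {Y : Multiset (Fml P)} (hY : ∀ A ∈ Y, A.IsAdditive)
    (h : 3 ≤ Y.card) : chainProd Y = 4 := by
  have key : ∀ n (Y : Multiset (Fml P)), (∀ A ∈ Y, A.IsAdditive) → Y.card = n + 3 →
      chainProd Y = 4 := by
    intro n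
    induction n with
    | zero =>
      intro Y hY hc
      obtain ⟨A, B, C, rfl⟩ := Multiset.card_eq_three.1 hc
      simp only [Multiset.insert_eq_cons, ← Multiset.cons_zero, chainProd_cons, chainProd_zero,
        (hY A (by simp)).chainEval_eq, (hY B (by simp)).chainEval_eq,
        (hY C (by simp)).chainEval_eq]
      decide
    | succ n ih =>
      intro Y hY hc
      obtain ⟨A, hA⟩ := Multiset.card_pos_iff_exists_mem.1 (by omega : 0 < Y.card)
      obtain ⟨Y, rfl⟩ := Multiset.exists_cons_of_mem hA
      rw [Multiset.card_cons] at hc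
      rw [chainProd_cons, (hY _ (Multiset.mem_cons_self _ _)).chainEval_eq,
        ih Y (fun B hB => hY B (Multiset.mem_cons_of_mem hB)) (by omega)]
      -- The top value `4` absorbs the middle value `2`.
      decide
  exact key (Y.card - 3) Y hY (by omega)

lemma Inconsistent.card_eq_one_or_two {Y : Multiset (Fml P)} (h : Inconsistent Y)
    (hY : ∀ A ∈ Y, A.IsAdditive) : Y.card = 1 ∨ Y.card = 2 := by
  have h0 : Y.card ≠ 0 := fun h0 => consistent_zero (Multiset.card_eq_zero.1 h0 ▸ h)
  have h3 : ¬ 3 ≤ Y.card := fun h3 => by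
    have := RDeriv.chainProd_le h
    rw [chainProd_of_three_le_card hY h3] at this
    exact absurd this (by decide : ¬ (4 : Fin 5) ≤ 3)
  omega

end Models

/-! ### Derived rules: deduction theorem, complements, contraction and cut. -/

section Derivations

namespace RDeriv

lemma mp {Γ : Multiset (Fml P)} {A B : Fml P} (h : RDeriv Γ A) (h' : RDeriv 0 (limp A B)) :
    RDeriv Γ B := by
  simpa using limp_rule h h'

lemma mp_ax {Γ : Multiset (Fml P)} {A B : Fml P} (h : RDeriv Γ A) (h' : RAxiom (limp A B)) :
    RDeriv Γ B := h.mp (.ax h')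

/-- The deduction theorem. -/
theorem deduction {A B : Fml P} {Γ : Multiset (Fml P)} (h : RDeriv (A ::ₘ Γ) B) :
    RDeriv Γ (limp A B) := by
  generalize hΔ : A ::ₘ Γ = Δ at h
  induction h generalizing Γ with
  | assumption B =>
    have hΓ : Γ = 0 := Multiset.card_eq_zero.1 (by simpa using congrArg Multiset.card hΔ)
    subst hΓ
    obtain rfl : A = B := by simpa using hΔ
    exact .ax (.id A)
  | ax h => exact absurd hΔ (Multiset.cons_ne_zero)
  | @limp_rule Γ₁ Γ₂ C D h h' ih ih' =>
    -- The contexts are added, so the discharged copy of `A` comes from one premise only; in the `&`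
    -- rule the context is shared and both premises discharge it.
    have hA : A ∈ Γ₁ + Γ₂ := hΔ ▸ Multiset.mem_cons_self A Γ
    rcases Multiset.mem_add.1 hA with hA | hA
    · obtain ⟨Γ₁, rfl⟩ := Multiset.exists_cons_of_mem hA
      rw [Multiset.cons_add, Multiset.cons_inj_right] at hΔ
      rw [hΔ, add_comm]
      exact limp_rule h' ((ih rfl).mp_ax (.trans A C D))
    · obtain ⟨Γ₂, rfl⟩ := Multiset.exists_cons_of_mem hA
      rw [Multiset.add_cons, Multiset.cons_inj_right] at hΔ
      rw [hΔ]
      exact limp_rule h ((ih' rfl).mp_ax (.exch A C D))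
  | wth_rule h h' ih ih' => exact (wth_rule (ih hΔ) (ih' hΔ)).mp_ax (.wth_intro _ _ _)

lemma contrapose {Γ : Multiset (Fml P)} {A B : Fml P} (h : RDeriv Γ (limp A B)) :
    RDeriv Γ (limp (neg B) (neg A)) := h.mp_ax (.contrapos A B)

/-- Double negation introduction, obtained from the De Morgan axiom for `A & A`. -/
lemma neg_neg {Γ : Multiset (Fml P)} {A : Fml P} (h : RDeriv Γ A) : RDeriv Γ (neg (neg A)) :=
  ((wth_rule h h).mp_ax (.wth_def A A)).mp (contrapose (.ax (.plus_left (neg A) (neg A))))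

lemma neg_bot : RDeriv (0 : Multiset (Fml P)) (neg bot) :=
  (neg_neg (.ax .one)).mp (contrapose (.ax .bot_def))

lemma neg_of_limp_bot {Γ : Multiset (Fml P)} {A : Fml P} (h : RDeriv Γ (limp A bot)) :
    RDeriv Γ (neg A) := by
  simpa using limp_rule neg_bot h.contrapose

lemma of_compl_limp_bot {Γ : Multiset (Fml P)} {A : Fml P} (h : RDeriv Γ (limp A.compl bot)) :
    RDeriv Γ A := by
  cases A with
  | neg B => exact h.neg_of_limp_bot
  | _ => exact h.neg_of_limp_bot.mp_ax (.dne _)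

end RDeriv

lemma inconsistent_neg (A : Fml P) : Inconsistent {A, neg A} := by
  have h : RDeriv {A} (limp one A) :=
    (RDeriv.assumption A).mp ((RDeriv.ax (.one_elim A)).mp_ax (.exch one A A))
  have := (RDeriv.limp_rule (.assumption (neg A)) h.contrapose).mp_ax .bot_def'
  rwa [add_comm] at this

lemma inconsistent_compl (A : Fml P) : Inconsistent {A, A.compl} := by
  cases A with
  | neg B => rw [Multiset.pair_comm]; exact inconsistent_neg B
  | _ => exact inconsistent_neg _

/-- Discharging both copies gives `A ⊸ (A ⊸ ⊥)`, which contraction reduces to `A ⊸ ⊥`. -/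
lemma Inconsistent.contradiction {A : Fml P} (h : Inconsistent {A, A}) : Contradiction A := by
  have h1 : RDeriv (A ::ₘ 0) (limp A bot) := RDeriv.deduction h
  exact (RDeriv.assumption A).mp (h1.deduction.mp_ax (.contraction A bot))

/-- A cut on `C`: if `D` is inconsistent with `C` and `E` with its complement, then `D` is
inconsistent with `E`. -/
lemma Inconsistent.cut {C D E : Fml P} (h : Inconsistent {C, D}) (h' : Inconsistent {C.compl, E}) :
    Inconsistent {D, E} := by
  have h1 : RDeriv {D} (limp C bot) := RDeriv.deduction h
  have h2 : RDeriv {E} (limp C.compl bot) := RDeriv.deduction h'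
  have := RDeriv.limp_rule h2.of_compl_limp_bot h1
  rwa [add_comm] at this

lemma compl_ne (A : Fml P) : A.compl ≠ A := by
  have h (B : Fml P) : B ≠ neg B := fun h => by
    have := congrArg sizeOf h
    simp at this
  cases A with
  | neg B => exact h B
  | _ => exact (h _).symm

end Derivations

/-! ### Robust consistency over an agenda, and complete extensions. -/

section Agenda

variable {Φ J : Multiset (Fml P)}

lemma RobustlyConsistent.of_le {Y Z : Multiset (Fml P)} (h : RobustlyConsistent Y) (hZ : Z ≤ Y) :
    Consistent Z := by
  rcases hZ.eq_or_lt with rfl | hZ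
  exacts [h.1, h.2 Z hZ]

/-- Distinctness is what makes `{A, B}` a submultiset: `J` may contain a formula only once. -/
lemma RobustlyConsistent.pair {A B : Fml P} (h : RobustlyConsistent J) (hA : A ∈ J) (hB : B ∈ J)
    (hne : A ≠ B) : Consistent {A, B} :=
  h.of_le <| (Multiset.le_iff_subset (by simp [hne])).2 (by simp [Multiset.subset_iff, hA, hB])

lemma RobustlyConsistent.compl_notMem {A : Fml P} (h : RobustlyConsistent J) (hA : A ∈ J) :
    A.compl ∉ J :=
  fun hA' => h.pair hA hA' (compl_ne A).symm (inconsistent_compl A)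

lemma IsARAgenda.not_inconsistent_self (hΦ : IsARAgenda Φ) {A : Fml P} (hA : A ∈ Φ) :
    ¬ Inconsistent {A, A} := fun h => hΦ.not_contradiction A hA h.contradiction

/-- Robust consistency of a judgment multiset on an additive agenda only depends on the pairs of
distinct formulas in it. -/
lemma IsARAgenda.robustlyConsistent (hΦ : IsARAgenda Φ) (hJ : J ≤ Φ)
    (h : ∀ A ∈ J, ∀ B ∈ J, A ≠ B → Consistent {A, B}) : RobustlyConsistent J := by
  have key : ∀ Z ≤ J, Consistent Z := by
    intro Z hZ hinc
    have hΦZ : ∀ A ∈ Z, A ∈ Φ := fun A hA => Multiset.mem_of_le (hZ.trans hJ) hA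
    rcases hinc.card_eq_one_or_two fun A hA => hΦ.additive A (hΦZ A hA) with hc | hc
    · obtain ⟨A, rfl⟩ := Multiset.card_eq_one.1 hc
      exact hΦ.not_contradiction A (hΦZ A (by simp)) hinc
    · obtain ⟨A, B, rfl⟩ := Multiset.card_eq_two.1 hc
      by_cases hAB : A = B
      · subst hAB
        exact hΦ.not_inconsistent_self (hΦZ A (by simp)) hinc
      · exact h A (Multiset.mem_of_le hZ (by simp)) B (Multiset.mem_of_le hZ (by simp)) hAB hinc
  exact ⟨key J le_rfl, fun Z hZ => key Z hZ.le⟩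

/-- Every formula of an additive agenda belongs to a robustly consistent and complete judgment
multiset. -/
lemma IsARAgenda.exists_mem_completeJudgments (hΦ : IsARAgenda Φ) {A : Fml P} (hA : A ∈ Φ) :
    ∃ K ∈ CompleteJudgments Φ, A ∈ K := by
  classical
  -- The case `B = C` is included, so that the final cut also covers `D = E`.
  let S : Set (Finset (Fml P)) :=
    {s | s ⊆ Φ.toFinset ∧ ∀ B ∈ s, ∀ C ∈ s, Consistent {B, C}}
  have hS : S.Finite := (Φ.toFinset.powerset.finite_toSet).subset fun s hs => by
    simpa using hs.1
  have hAS : {A} ∈ S := by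
    refine ⟨by simpa using hA, ?_⟩
    simpa [Consistent] using hΦ.not_inconsistent_self hA
  obtain ⟨s, hAs, hs⟩ := hS.exists_le_maximal hAS
  have hsΦ : ∀ B ∈ s, B ∈ Φ := fun B hB => Multiset.mem_toFinset.1 (hs.prop.1 hB)
  have hle : s.val ≤ Φ := (Multiset.le_iff_subset s.nodup).2 fun B hB => hsΦ B hB
  have ext : ∀ C ∈ Φ, C ∉ s → ∃ D ∈ s, Inconsistent {C, D} := by
    intro C hC hCs
    by_contra! hcon
    refine hCs (hs.le_of_ge (y := insert C s) ⟨?_, ?_⟩ (Finset.subset_insert C s)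
      (Finset.mem_insert_self C s))
    · exact Finset.insert_subset (Multiset.mem_toFinset.2 hC) hs.prop.1
    · intro B hB D hD
      rcases Finset.mem_insert.1 hB with rfl | hBs <;> rcases Finset.mem_insert.1 hD with rfl | hDs
      · exact hΦ.not_inconsistent_self hC
      · exact hcon D hDs
      · rw [Multiset.pair_comm]; exact hcon B hBs
      · exact hs.prop.2 B hBs D hDs
  refine ⟨s.val, ⟨hle, hΦ.robustlyConsistent hle fun B hB C hC _ => hs.prop.2 B hB C hC, ?_⟩,
    hAs (Finset.mem_singleton_self A)⟩
  intro C hC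
  by_contra! hcon
  -- By maximality `C` and `∼C` each clash with a member of `s`; cutting on `C` makes these two
  -- members clash.
  obtain ⟨D, hD, hCD⟩ := ext C hC hcon.1
  obtain ⟨E, hE, hCE⟩ := ext _ (hΦ.compl_mem C hC) hcon.2
  exact hs.prop.2 D hD E hE (hCD.cut hCE)

end Agenda

/-! ### Majority rules and safety for MAJ. -/

section Aggregation

variable {Φ : Multiset (Fml P)} {n : ℕ} {D : Set (Multiset (Fml P))}

lemma Aggregator.IsMajorityRule.isRobustlyConsistent {F : Aggregator n D Φ}
    (hF : F.IsMajorityRule) (hΦ : IsARAgenda Φ) (hD : ∀ J ∈ D, RobustlyConsistent J) :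
    F.IsRobustlyConsistent := by
  intro J
  refine hΦ.robustlyConsistent (F J).2 fun A hA B hB hAB => ?_
  rw [hF J] at hA hB
  by_contra hinc
  -- No agent accepts both members of an inconsistent pair, so two strict majorities would need more
  -- than `n` agents.
  have hdisj : Disjoint {i | A ∈ (J i).1} {i | B ∈ (J i).1} :=
    Set.disjoint_left.2 fun i hiA hiB => hinc ((hD _ (J i).2).pair hiA hiB hAB)
  have hcard : ({i | A ∈ (J i).1} : Set (Fin n)).ncard +
      ({i | B ∈ (J i).1} : Set (Fin n)).ncard ≤ n := by
    rw [← Set.ncard_union_eq hdisj]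
    simpa using Set.ncard_le_ncard (Set.subset_univ ({i | A ∈ (J i).1} ∪ {i | B ∈ (J i).1}))
  have : (({i | A ∈ (J i).1} : Set (Fin n)).ncard : ℝ) +
      ({i | B ∈ (J i).1} : Set (Fin n)).ncard ≤ n := mod_cast hcard
  linarith

/-- Monotonicity for the replacement of the judgments of several agents. -/
lemma Aggregator.Monotonic.mem_of_ite {F : Aggregator n D Φ} (hF : F.Monotonic) {A : Fml P}
    (hA : A ∈ Φ) {J : Fin n → D} {K : D} (hAK : A ∈ K.1) (hAF : A ∈ (F J).1) (T : Finset (Fin n))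
    (hT : ∀ i ∈ T, A ∉ (J i).1) : A ∈ (F fun i => if i ∈ T then K else J i).1 := by
  induction T using Finset.induction_on with
  | empty => simpa using hAF
  | insert j T hj ih =>
    have h := hF A hA (fun i => if i ∈ T then K else J i) j K
      (by simpa [hj] using hT j (Finset.mem_insert_self j T)) hAK
      (ih fun i hi => hT i (Finset.mem_insert_of_mem hi))
    convert h using 3
    funext i
    by_cases hi : i = j
    · subst hi; simp
    · simp [hi]

theorem IsARAgenda.safeForMAJ (hΦ : IsARAgenda Φ) (n : ℕ) : SafeForMAJ n Φ := by
  classical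
  rintro F ⟨hWR, -, hI, hN, hM⟩ J
  refine hΦ.robustlyConsistent (F J).2 fun A hA B hB hAB hinc => ?_
  have hAΦ : A ∈ Φ := Multiset.mem_of_le (F J).2 hA
  have hBΦ : B ∈ Φ := Multiset.mem_of_le (F J).2 hB
  obtain ⟨K, hK, hAK⟩ := hΦ.exists_mem_completeJudgments hAΦ
  have hBK : B ∉ K := fun hBK => hK.2.1.pair hAK hBK hAB hinc
  -- Agents accepting neither `A` nor `B` are switched to accepting `A`.
  let T : Finset (Fin n) := {i | A ∉ (J i).1 ∧ B ∉ (J i).1}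
  let J' : Fin n → CompleteJudgments Φ := fun i => if i ∈ T then ⟨K, hK⟩ else J i
  have hA' : A ∈ (F J').1 :=
    hM.mem_of_ite hAΦ (K := ⟨K, hK⟩) hAK hA T fun i hi => (Finset.mem_filter.1 hi).2.1
  have hB' : B ∈ (F J').1 := by
    -- A switched agent accepts `B` neither before nor after the switch.
    refine (hI B hBΦ J J' fun i => ?_).1 hB
    by_cases hi : i ∈ T
    · simp [J', hi, hBK, (Finset.mem_filter.1 hi).2.2]
    · simp [J', hi]
  -- In `J'` every agent accepts exactly one of `A` and `B`, and exactly one of `A` and `∼A`; hence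
  -- `B` and `∼A` have the same supporters.
  refine hWR J' |>.2 A ⟨hA', (hN B hBΦ _ (hΦ.compl_mem A hAΦ) J' fun i => ?_).1 hB'⟩
  by_cases hi : i ∈ T
  · simpa [J', hi, hBK] using hK.2.1.compl_notMem hAK
  · simp only [J', if_neg hi]
    obtain ⟨-, hcons, hcomp⟩ := (J i).2
    constructor
    · intro hBi
      exact (hcomp A hAΦ).resolve_left fun hAi => hcons.pair hAi hBi hAB hinc
    · intro hAi
      by_contra hBi
      exact hi (by simpa [T] using ⟨fun h => hcons.compl_notMem h hAi, hBi⟩)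

end Aggregation

end RelevantJA
theorem theorem40 {P : Type*} :
    (∀ Y : Multiset (Fml P), (∀ A ∈ Y, A.IsAdditive) → Inconsistent Y →
      Y.card = 1 ∨ Y.card = 2) ∧
    (∀ Y : Multiset (Fml P), (∀ A ∈ Y, A.IsAdditive) → MinimallyInconsistent Y →
      (∀ A ∈ Y, ¬ Contradiction A) → Y.card = 2) ∧
    (∀ Φ : Multiset (Fml P), IsARAgenda Φ → ∀ n : ℕ, Odd n → 3 ≤ n →
      SafeForMAJ n Φ ∧
      (∀ F : Aggregator n (Judgments Φ) Φ, F.IsMajorityRule → F.IsRobustlyConsistent) ∧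
      (∀ F : Aggregator n (CompleteJudgments Φ) Φ, F.IsMajorityRule → F.IsRobustlyConsistent)) := by
  refine ⟨fun Y hY h => h.card_eq_one_or_two hY, fun Y hY h hcon => ?_, fun Φ hΦ n _ _ =>
    ⟨hΦ.safeForMAJ n, fun F hF => hF.isRobustlyConsistent hΦ fun J hJ => hJ.2,
      fun F hF => hF.isRobustlyConsistent hΦ fun J hJ => hJ.2.1⟩⟩
  refine (h.1.card_eq_one_or_two hY).resolve_left fun hc => ?_
  obtain ⟨A, rfl⟩ := Multiset.card_eq_one.1 hc
  exact hcon A (Multiset.mem_singleton_self A) h.1
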